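/- Let $(E,d)$ be a geodesic Polish metric space (every pair $x,y$ is joined by a geodesic, i.e. a continuous curve on $[0,d(x,y)]$ from $x$ to $y$ whose length, the supremum of the sums of the distances between consecutive points over finite subdivisions, is $d(x,y)$), with its Borel $\sigma$-algebra. Let $\Delta>0$ and $\alpha\in(0,1)$. A $\Delta$-subdivision is a function $F:I\to E$ with bounded image on a bounded interval $I\subset\mathbb R$ with $\sup I-\inf I=\Delta$, measurable from the Lebesgue completion of the Borel sets of $I$ to the Borel sets of $E$. Two $\Delta$-subdivisions are identified if their intervals have the same infimum and the same supremum and they agree Lebesgue-almost everywhere on the common domain; $s^\Delta$ denotes the resulting space. For $P,Q\in s^\Delta$ with intervals $I^P$, $I^Q$ and $a=\inf I^P$, $b=\sup I^P$, $c=\inf I^Q$, $e=\sup I^Q$, put $$D^\alpha_\Delta(P,Q)=\int_a^b\Bigl((1-\alpha)\,d\bigl(P(t),Q(t+c-a)\bigr)+\alpha\,|c-a|\Bigr)\,dt .$$ Then $D^\alpha_\Delta$ is a metric on $s^\Delta$ and $(s^\Delta,D^\alpha_\Delta)$ is a geodesic metric space. More precisely, for all $P,Q$ as above there are a Borel map $g:E\times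 E\to C([0,1],E)$ (uniform topology) and $\Delta$-subdivisions $G^T$, $T\in[0,1]$, such that: 1. for almost every $t\in I^P$, $\gamma_t:=g\bigl(P(t),Q(t+c-a)\bigr)$ is a constant-speed $d$-geodesic from $P(t)$ to $Q(t+c-a)$, i.e. $\gamma_t(0)=P(t)$, $\gamma_t(1)=Q(t+c-a)$ and $d(\gamma_t(S),\gamma_t(T))=|T-S|\,d(P(t),Q(t+c-a))$ for all $S,T\in[0,1]$; 2. for every $T\in[0,1]$, the interval $I^T$ of $G^T$ satisfies $\inf I^T=(1-T)a+Tc$ and $\sup I^T=(1-T)b+Te$, and $G^T(t+\inf I^T-a)=\gamma_t(T)$ for almost every $t\in I^P$; 3. $G^0=P$ and $G^1=Q$ in $s^\Delta$, and $D^\alpha_\Delta(G^S,G^T)=|T-S|\,D^\alpha_\Delta(P,Q)$ for all $S,T\in[0,1]$; that is, $T\mapsto G^T$ is a constant-speed geodesic from $P$ to $Q$. -/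

import Mathlib

open MeasureTheory Set

namespace ContinuousEditDistance

/-- `γ` is a geodesic from `x` to `y`: a continuous curve on `[0, d(x, y)]` from `x` to `y` whose
length (the supremum of `∑ d(γ(tᵢ), γ(tᵢ₊₁))` over finite subdivisions) is `d(x, y)`.
Values of `γ` outside `[0, d(x, y)]` are irrelevant. -/
def IsGeodesic {X : Type*} [PseudoMetricSpace X] (x y : X) (γ : ℝ → X) : Prop :=
  ContinuousOn γ (Icc 0 (dist x y)) ∧ γ 0 = x ∧ γ (dist x y) = y ∧
    eVariationOn γ (Icc 0 (dist x y)) = ENNReal.ofReal (dist x y)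

/-- Every pair of points is joined by a geodesic. -/
def IsGeodesicSpace (X : Type*) [PseudoMetricSpace X] : Prop :=
  ∀ x y : X, ∃ γ : ℝ → X, IsGeodesic x y γ

/-- `γ : [0, 1] → X` is a constant-speed geodesic from `x` to `y`. -/
def IsConstantSpeedGeodesic {X : Type*} [PseudoMetricSpace X] (x y : X)
    (γ : unitInterval → X) : Prop :=
  γ 0 = x ∧ γ 1 = y ∧
    ∀ S T : unitInterval, dist (γ S) (γ T) = |(T : ℝ) - (S : ℝ)| * dist x y

/-- A `Δ`-subdivision, before identification of almost-everywhere equal ones: a Lebesgue-measurable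
function with bounded image, on a bounded interval `dom` of length `Δ` (open, closed or half-open).
The function is represented by a function on `ℝ`, whose values outside `dom` are irrelevant.
Measurability is with respect to the Lebesgue completion of the Borel sets of `dom`.
A time-varying function is a finite family of these over successive intervals, so the
subdivisions of time-varying functions are exactly these (each being a family of one). -/
structure SubdivisionRep (E : Type*) [MetricSpace E] [MeasurableSpace E] (Δ : ℝ) where
  dom : Set ℝ
  toFun : ℝ → E
  ordConnected_dom : dom.OrdConnected
  isBounded_dom : Bornology.IsBounded dom
  length_dom : sSup dom - sInf dom = Δ
  nullMeasurable : NullMeasurable toFun (volume.restrict dom)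
  isBounded_image : Bornology.IsBounded (toFun '' dom)

namespace SubdivisionRep

variable {E : Type*} [MetricSpace E] [MeasurableSpace E] {Δ : ℝ}

/-- The infimum of the time interval. -/
noncomputable def left (P : SubdivisionRep E Δ) : ℝ := sInf P.dom

/-- The supremum of the time interval. -/
noncomputable def right (P : SubdivisionRep E Δ) : ℝ := sSup P.dom

/-- Two `Δ`-subdivisions are equal if their intervals have the same infimum and supremum and
their values agree almost everywhere on the common domain. -/
def Equiv (P Q : SubdivisionRep E Δ) : Prop :=
  P.left = Q.left ∧ P.right = Q.right ∧
    volume {t : ℝ | t ∈ P.dom ∩ Q.dom ∧ P.toFun t ≠ Q.toFun t} = 0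

theorem Ioo_subset_dom (P : SubdivisionRep E Δ) : Ioo P.left P.right ⊆ P.dom := by
  intro t ht
  have hne : P.dom.Nonempty := by
    by_contra h
    rw [Set.not_nonempty_iff_eq_empty] at h
    have h1 := ht.1
    have h2 := ht.2
    simp only [left, right, h, Real.sInf_empty, Real.sSup_empty] at h1 h2
    linarith
  obtain ⟨x, hx, hxt⟩ := exists_lt_of_csInf_lt hne ht.1
  obtain ⟨y, hy, hty⟩ := exists_lt_of_lt_csSup hne ht.2
  exact P.ordConnected_dom.out hx hy ⟨hxt.le, hty.le⟩

theorem dom_subset_Icc (P : SubdivisionRep E Δ) : P.dom ⊆ Icc P.left P.right := fun _ ht =>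
  ⟨csInf_le P.isBounded_dom.bddBelow ht, le_csSup P.isBounded_dom.bddAbove ht⟩

theorem Equiv.ae {P Q : SubdivisionRep E Δ} (h : Equiv P Q) :
    ∀ᵐ t : ℝ, t ∈ Ioo P.left P.right → P.toFun t = Q.toFun t := by
  refine ae_iff.2 (measure_mono_null ?_ h.2.2)
  intro t ht
  replace ht := Classical.not_imp.1 ht
  refine ⟨⟨P.Ioo_subset_dom ht.1, Q.Ioo_subset_dom ?_⟩, ht.2⟩
  rw [← h.1, ← h.2.1]
  exact ht.1

theorem Equiv.refl (P : SubdivisionRep E Δ) : Equiv P P := ⟨rfl, rfl, by simp⟩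

theorem Equiv.symm {P Q : SubdivisionRep E Δ} (h : Equiv P Q) : Equiv Q P := by
  refine ⟨h.1.symm, h.2.1.symm, measure_mono_null ?_ h.2.2⟩
  exact fun t ht => ⟨⟨ht.1.2, ht.1.1⟩, ht.2.symm⟩

theorem Equiv.trans {P Q R : SubdivisionRep E Δ} (h : Equiv P Q) (h' : Equiv Q R) :
    Equiv P R := by
  refine ⟨h.1.trans h'.1, h.2.1.trans h'.2.1, ?_⟩
  have h1 := h'.ae
  rw [← h.1, ← h.2.1] at h1
  have key : ∀ᵐ t : ℝ, ¬ (t ∈ P.dom ∩ R.dom ∧ P.toFun t ≠ R.toFun t) := by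
    filter_upwards [h.ae, h1, Measure.ae_ne volume P.left,
      Measure.ae_ne volume P.right] with t h2 h3 h4 h5
    rintro ⟨⟨hP, -⟩, hne⟩
    have hI := P.dom_subset_Icc hP
    have hI' : t ∈ Ioo P.left P.right := ⟨lt_of_le_of_ne hI.1 h4.symm, lt_of_le_of_ne hI.2 h5⟩
    exact hne ((h2 hI').trans (h3 hI'))
  refine measure_mono_null (fun t ht => ?_) (ae_iff.1 key)
  exact not_not.2 ht

instance setoid (E : Type*) [MetricSpace E] [MeasurableSpace E] (Δ : ℝ) :
    Setoid (SubdivisionRep E Δ) where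
  r := Equiv
  iseqv := ⟨Equiv.refl, Equiv.symm, Equiv.trans⟩

/-- The integral of `(1 - α) d(P(t), Q(t + c - a)) + α |c - a|` over `t` from `a` to `b`, where
`a`, `b` are the endpoints of the interval of `P` and `c` is the left endpoint of that of `Q`. -/
noncomputable def cost (α : ℝ) (P Q : SubdivisionRep E Δ) : ℝ :=
  ∫ t in P.left..P.right,
    ((1 - α) * dist (P.toFun t) (Q.toFun (t + Q.left - P.left)) + α * |Q.left - P.left|)

theorem cost_congr (α : ℝ) {P Q P' Q' : SubdivisionRep E Δ} (hP : Equiv P P') (hQ : Equiv Q Q') :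
    cost α P Q = cost α P' Q' := by
  have hsh : ∀ᵐ t : ℝ, t + (Q.left - P.left) ∈ Ioo Q.left Q.right →
      Q.toFun (t + (Q.left - P.left)) = Q'.toFun (t + (Q.left - P.left)) :=
    (measurePreserving_add_right volume (Q.left - P.left)).quasiMeasurePreserving.ae hQ.ae
  have hlen : P.right - P.left = Q.right - Q.left := P.length_dom.trans Q.length_dom.symm
  unfold cost
  rw [← hP.1, ← hP.2.1, ← hQ.1]
  refine intervalIntegral.integral_congr_ae ?_
  have hnn : P.left ≤ P.right := by
    rcases P.dom.eq_empty_or_nonempty with h | ⟨x, hx⟩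
    · simp [left, right, h]
    · exact (P.dom_subset_Icc hx).1.trans (P.dom_subset_Icc hx).2
  filter_upwards [hP.ae, hsh, Measure.ae_ne volume P.right] with t h1 h2 h3 ht
  rw [uIoc_of_le hnn] at ht
  have ht' : t < P.right := lt_of_le_of_ne ht.2 h3
  rw [h1 ⟨ht.1, ht'⟩, add_sub_assoc, h2 ⟨by linarith [ht.1], by linarith⟩]

end SubdivisionRep

/-- The space of `Δ`-subdivisions, almost-everywhere equal ones being identified. -/
def SubdivisionSpace (E : Type*) [MetricSpace E] [MeasurableSpace E] (Δ : ℝ) : Type _ :=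
  Quotient (SubdivisionRep.setoid E Δ)

/-- The element of the space of `Δ`-subdivisions given by `P`. -/
def SubdivisionRep.toSpace {E : Type*} [MetricSpace E] [MeasurableSpace E] {Δ : ℝ}
    (P : SubdivisionRep E Δ) : SubdivisionSpace E Δ :=
  Quotient.mk (SubdivisionRep.setoid E Δ) P

/-- The distance `D` with time weight `α` on the space of `Δ`-subdivisions. -/
noncomputable def subdivisionDist {E : Type*} [MetricSpace E] [MeasurableSpace E] {Δ : ℝ} (α : ℝ)
    (p q : SubdivisionSpace E Δ) : ℝ :=
  Quotient.lift₂ (SubdivisionRep.cost α)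
    (fun _ _ _ _ hP hQ => SubdivisionRep.cost_congr α hP hQ) p q

end ContinuousEditDistance

/-! Shifted to start at time 0, a subdivision is a starting time together with a curve, bounded on
(0, Δ) and taken modulo null sets. In these coordinates (`cost_eq`) the cost is (1 - α) times the L¹
distance of the curves plus αΔ times the distance of the starting times, so it is a metric. Moving
the starting time linearly and each value at constant speed along a geodesic multiplies both terms
by |T - S|. What remains is to choose the geodesics measurably.

Pairs of points with a constant-speed geodesic joining them form a closed, hence Polish, subset of
(E × E) × C([0,1], E), which projects onto E × E. A Borel section is needed only almost everywhere
for the joint law of the values of P and Q, which is why g may depend on P and Q.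
`Continuous.exists_measurable_ae_rightInverse` supplies it: the Polish space is a continuous image
of ℕ^ℕ, images of compact sets of sequences exhaust the finite measure, and over each such image the
Cantor set parametrizes the compact set, so that the least preimage is a Borel choice. -/

/-! ### Borel sections of continuous surjections -/

/-- A continuous function on a compact set of real numbers has a Borel section on its range,
which picks the least preimage. -/
theorem IsCompact.exists_measurable_section_real {X : Type*} [TopologicalSpace X] [T2Space X]
    [MeasurableSpace X] [BorelSpace X] {C : Set ℝ} (hC : IsCompact C) (hne : C.Nonempty)
    {F : C → X} (hF : Continuous F) :
    ∃ s : X → C, Measurable s ∧ ∀ x ∈ range F, F (s x) = x := by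
  classical
  have : CompactSpace C := isCompact_iff_compactSpace.1 hC
  have key : ∀ x, ∃ c : C, (x ∈ range F → F c = x ∧ ∀ c', F c' = x → c ≤ c') ∧
      (x ∉ range F → c = ⟨hne.some, hne.some_mem⟩) := by
    intro x
    by_cases hx : x ∈ range F
    · have h1 : IsCompact (F ⁻¹' {x}) := (isClosed_singleton.preimage hF).isCompact
      obtain ⟨c, hc, hmin⟩ := h1.exists_isLeast hx
      exact ⟨c, fun _ => ⟨hc, fun c' hc' => hmin hc'⟩, fun h => absurd hx h⟩
    · exact ⟨_, fun h => absurd h hx, fun _ => rfl⟩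
  choose s hs hs' using key
  refine ⟨s, ?_, fun x hx => (hs x hx).1⟩
  have hm : Measurable fun x => (s x : ℝ) := by
    refine measurable_of_Iic fun c => ?_
    have hr : MeasurableSet (range F) := (isCompact_range hF).isClosed.measurableSet
    have h1 : MeasurableSet (F '' {p | (p : ℝ) ≤ c}) :=
      ((isClosed_le continuous_subtype_val continuous_const).isCompact.image hF).isClosed.measurableSet
    -- On the range, the least preimage is at most `c` exactly when some preimage is. Off the range
    -- the section is constant.
    have h2 : (fun x => (s x : ℝ)) ⁻¹' Iic c =
        F '' {p | (p : ℝ) ≤ c} ∪ ((range F)ᶜ ∩ {_x | hne.some ≤ c}) := by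
      ext x
      by_cases hx : x ∈ range F
      · simp only [mem_preimage, mem_Iic, mem_union, mem_inter_iff, mem_compl_iff, hx,
          not_true_eq_false, false_and, or_false]
        constructor
        · exact fun h => ⟨s x, h, (hs x hx).1⟩
        · rintro ⟨p, hp, rfl⟩
          exact le_trans ((hs _ hx).2 p rfl) hp
      · have : x ∉ F '' {p | (p : ℝ) ≤ c} := fun h => hx (image_subset_range _ _ h)
        simp [hs' x hx, hx, this]
    rw [h2]
    exact h1.union (hr.compl.inter (MeasurableSet.const _))
  exact hm.subtype_mk

/-- A continuous function has a Borel section over the image of a nonempty compact set. -/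
theorem IsCompact.exists_measurable_section {X Y : Type*} [TopologicalSpace X] [T2Space X]
    [MeasurableSpace X] [BorelSpace X] [MetricSpace Y] [MeasurableSpace Y] [BorelSpace Y]
    {K : Set Y} (hK : IsCompact K) (hne : K.Nonempty) {f : Y → X} (hf : Continuous f) :
    ∃ s : X → Y, Measurable s ∧ ∀ x ∈ f '' K, f (s x) = x := by
  have : CompactSpace K := isCompact_iff_compactSpace.1 hK
  have : Nonempty K := hne.to_subtype
  obtain ⟨h, hc, hsurj⟩ := exists_nat_bool_continuous_surjective_of_compact K
  have hG : Continuous fun c : cantorSet => (h (cantorSetHomeomorphNatToBool c) : Y) :=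
    continuous_subtype_val.comp (hc.comp cantorSetHomeomorphNatToBool.continuous)
  obtain ⟨s, hs, hs'⟩ :=
    isCompact_cantorSet.exists_measurable_section_real ⟨0, zero_mem_cantorSet⟩ (hf.comp hG)
  refine ⟨_, hG.measurable.comp hs, ?_⟩
  rintro x ⟨y, hy, rfl⟩
  refine hs' _ ?_
  obtain ⟨b, hb⟩ := hsurj ⟨y, hy⟩
  exact ⟨cantorSetHomeomorphNatToBool.symm b, by simp [hb]⟩

/-- An open set of sequences which contains a product of initial segments contains all sequences
that respect finitely many of the bounds. -/
theorem exists_forall_lt_subset_of_isOpen {n : ℕ → ℕ} {W : Set (ℕ → ℕ)} (hW : IsOpen W)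
    (h : {a : ℕ → ℕ | ∀ i, a i ≤ n i} ⊆ W) : ∃ k, {a : ℕ → ℕ | ∀ i < k, a i ≤ n i} ⊆ W := by
  by_contra! hcon
  simp only [not_subset] at hcon
  choose a ha haW using hcon
  have hK : IsCompact {a : ℕ → ℕ | ∀ i, a i ≤ n i} := by
    have := isCompact_univ_pi (fun i => (finite_Iic (n i)).isCompact)
    convert this using 1
    ext; simp [Pi.le_def]
  -- The truncations lie in the compact box. Coordinate `i` of `a k` is untouched by truncation once
  -- `k > i`, so the sequences themselves have the same limit along `φ`.
  obtain ⟨b, hb, φ, hφ, hlim⟩ :=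
    hK.tendsto_subseq (x := fun k i => min (a k i) (n i)) fun k i => min_le_right _ _
  have hlim' : Filter.Tendsto (fun k => a (φ k)) Filter.atTop (nhds b) := by
    rw [tendsto_pi_nhds] at hlim ⊢
    intro i
    refine (hlim i).congr' ?_
    filter_upwards [Filter.eventually_gt_atTop i] with k hk
    exact min_eq_left (ha _ _ (hk.trans_le hφ.le_apply))
  exact hW.isClosed_compl.mem_of_tendsto hlim' (Filter.Eventually.of_forall fun k => haW _) (h hb)

/-- A finite measure is inner regular for continuous images of compact sets of sequences. -/
theorem exists_isCompact_lt_measure_image {X : Type*} [TopologicalSpace X]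
    [MeasurableSpace X] (μ : Measure X) [μ.OuterRegular]
    {f : (ℕ → ℕ) → X} (hf : Continuous f) {c : ENNReal} (hc : c < μ (range f)) :
    ∃ K : Set (ℕ → ℕ), IsCompact K ∧ c ≤ μ (f '' K) := by
  have step : ∀ (k : ℕ) (A : {A : Set (ℕ → ℕ) // c < μ (f '' A)}),
      ∃ n : ℕ, c < μ (f '' (A.1 ∩ {a | a k ≤ n})) := by
    intro k A
    have hmono : Monotone fun n : ℕ => f '' (A.1 ∩ {a | a k ≤ n}) := fun m n hmn =>
      image_mono (inter_subset_inter_right _ fun a (ha : a k ≤ m) => ha.trans hmn)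
    have hU : f '' A.1 = ⋃ n : ℕ, f '' (A.1 ∩ {a | a k ≤ n}) := by
      rw [← image_iUnion, ← inter_iUnion]
      congr 1
      refine (inter_eq_left.2 fun a _ => mem_iUnion.2 ⟨a k, le_refl (a k)⟩).symm
    -- Continuity from below holds for any increasing sets, so the images need not be measurable.
    have h1 := A.2
    rw [hU, hmono.measure_iUnion] at h1
    exact lt_iSup_iff.1 h1
  choose N hN using step
  let S : ℕ → {A : Set (ℕ → ℕ) // c < μ (f '' A)} := fun k =>
    Nat.rec ⟨univ, by rwa [image_univ]⟩ (fun k A => ⟨_, hN k A⟩) k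
  have hS : ∀ k, (S k).1 = {a | ∀ i < k, a i ≤ N i (S i)} := by
    intro k
    induction k with
    | zero => ext a; simp [S]
    | succ k ih =>
      have : (S (k + 1)).1 = (S k).1 ∩ {a | a k ≤ N k (S k)} := rfl
      rw [this, ih]
      ext a
      simp only [mem_inter_iff, mem_ofPred_eq, Nat.lt_succ_iff_lt_or_eq]
      constructor
      · rintro ⟨h1, h2⟩ i (hi | rfl)
        exacts [h1 i hi, h2]
      · exact fun h => ⟨fun i hi => h i (Or.inl hi), h k (Or.inr rfl)⟩
  refine ⟨{a | ∀ i, a i ≤ N i (S i)}, ?_, ?_⟩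
  · have := isCompact_univ_pi (fun i => (finite_Iic (N i (S i))).isCompact)
    convert this using 1
    ext; simp [Pi.le_def]
  -- Images do not commute with decreasing intersections. Outer regularity replaces this: an open
  -- set around the image of the box already contains the image of some `S k`.
  · rw [Set.measure_eq_iInf_isOpen]
    refine le_iInf₂ fun V hV => le_iInf fun hVo => ?_
    obtain ⟨k, hk⟩ := exists_forall_lt_subset_of_isOpen (hVo.preimage hf) (image_subset_iff.1 hV)
    rw [← hS k] at hk
    exact (S k).2.le.trans (measure_mono (image_subset_iff.2 hk))

/-- A continuous surjection from a Polish space has a Borel right inverse off a Borel null set. -/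
theorem Continuous.exists_measurable_ae_rightInverse {X Y : Type*} [TopologicalSpace X] [T2Space X]
    [MeasurableSpace X] [BorelSpace X] [TopologicalSpace Y] [PolishSpace Y] [MeasurableSpace Y]
    [BorelSpace Y] (μ : Measure X) [IsFiniteMeasure μ] [μ.OuterRegular] [Nonempty Y]
    {f : Y → X} (hf : Continuous f) (hsurj : Function.Surjective f) :
    ∃ (s : X → Y) (N : Set X), Measurable s ∧ MeasurableSet N ∧ μ Nᶜ = 0 ∧
      ∀ x ∈ N, f (s x) = x := by
  classical
  obtain ⟨φ, hφ, hφs⟩ := PolishSpace.exists_nat_nat_continuous_surjective Y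
  by_cases hμ : μ univ = 0
  · exact ⟨fun _ => Classical.arbitrary Y, ∅, measurable_const, .empty, by simpa using hμ, by simp⟩
  have hr : range (f ∘ φ) = univ := (hsurj.comp hφs).range_eq
  have hK : ∀ j : ℕ, ∃ K : Set (ℕ → ℕ), IsCompact K ∧
      μ univ - ((j : ENNReal) + 1)⁻¹ ≤ μ (f ∘ φ '' K) := by
    intro j
    refine exists_isCompact_lt_measure_image μ (hf.comp hφ) ?_
    rw [hr]
    exact ENNReal.sub_lt_self (measure_ne_top _ _) hμ (by simp)
  choose K hKc hKμ using hK
  have hKm : ∀ j, MeasurableSet (f ∘ φ '' K j) := fun j =>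
    ((hKc j).image (hf.comp hφ)).isClosed.measurableSet
  have hsec : ∀ j, ∃ s : X → (ℕ → ℕ), Measurable s ∧ ∀ x ∈ f ∘ φ '' K j, f (φ (s x)) = x := by
    intro j
    rcases (K j).eq_empty_or_nonempty with h | h
    · exact ⟨fun _ => 0, measurable_const, by simp [h]⟩
    · let : MetricSpace (ℕ → ℕ) := TopologicalSpace.metrizableSpaceMetric _
      exact (hKc j).exists_measurable_section h (hf.comp hφ)
  choose s hsm hs using hsec
  let N : Set X := ⋃ j, f ∘ φ '' K j
  have hN : MeasurableSet N := .iUnion hKm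
  -- The alternative `x ∉ N` makes the search for the first index total; such points receive index
  -- 0.
  have hex : ∀ x, ∃ j, x ∈ f ∘ φ '' K j ∨ x ∉ N := by
    intro x
    by_cases hx : x ∈ N
    · obtain ⟨j, hj⟩ := mem_iUnion.1 hx
      exact ⟨j, Or.inl hj⟩
    · exact ⟨0, Or.inr hx⟩
  refine ⟨fun x => φ (s (Nat.find (hex x)) x), N,
    hφ.measurable.comp (Measurable.find (p := fun j x => x ∈ f ∘ φ '' K j ∨ x ∉ N) hsm
      (fun j => (hKm j).union hN.compl) hex), hN, ?_, ?_⟩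
  · have hle : ∀ j : ℕ, μ Nᶜ ≤ ((j : ENNReal) + 1)⁻¹ := by
      intro j
      refine (measure_mono (compl_subset_compl.2 (subset_iUnion _ j))).trans ?_
      rw [measure_compl (hKm j) (measure_ne_top _ _)]
      exact tsub_le_iff_tsub_le.1 (hKμ j)
    by_contra hne
    obtain ⟨j, hj⟩ := ENNReal.exists_inv_nat_lt hne
    refine absurd (hle j) (not_le.2 (lt_of_le_of_lt ?_ hj))
    exact ENNReal.inv_le_inv.2 le_self_add
  · intro x hx
    rcases Nat.find_spec (hex x) with h | h
    · exact hs _ x h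
    · exact absurd hx h

instance ContinuousMap.polishSpace {X E : Type*} [TopologicalSpace X] [CompactSpace X]
    [SecondCountableTopology X] [LocallyCompactSpace X] [TopologicalSpace E] [PolishSpace E] :
    PolishSpace C(X, E) := by
  let := TopologicalSpace.upgradeIsCompletelyMetrizable E
  infer_instance

/-! ### Geodesics and their measurable choice -/

namespace ContinuousEditDistance

/-- The distance from the starting point parametrizes a geodesic by arc length. -/
theorem IsGeodesic.dist_eq {X : Type*} [PseudoMetricSpace X] {x y : X} {γ : ℝ → X}
    (h : IsGeodesic x y γ) {s t : ℝ} (hs : 0 ≤ s) (hst : s ≤ t) (ht : t ≤ dist x y) :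
    dist (γ s) (γ t) = dist x (γ t) - dist x (γ s) := by
  obtain ⟨-, h0, h1, hV⟩ := h
  have e1 := eVariationOn.edist_le γ (s := Icc 0 s) (x := 0) (y := s) ⟨le_rfl, hs⟩ ⟨hs, le_rfl⟩
  have e2 := eVariationOn.edist_le γ (s := Icc s t) (x := s) (y := t) ⟨le_rfl, hst⟩ ⟨hst, le_rfl⟩
  have e3 := eVariationOn.edist_le γ (s := Icc t (dist x y)) (x := t) (y := dist x y)
    ⟨le_rfl, ht⟩ ⟨ht, le_rfl⟩
  have a1 := eVariationOn.Icc_add_Icc γ (s := univ) hs hst (mem_univ _)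
  have a2 := eVariationOn.Icc_add_Icc γ (s := univ) (hs.trans hst) ht (mem_univ _)
  simp only [univ_inter] at a1 a2
  rw [h0] at e1
  rw [h1] at e3
  -- The three chords are bounded by the lengths of three consecutive arcs, whose sum is d(x, y).
  -- This forces equality in the triangle inequalities.
  have hle := add_le_add (add_le_add e1 e2) e3
  rw [a1, a2, hV, edist_dist, edist_dist, edist_dist, ← ENNReal.ofReal_add, ← ENNReal.ofReal_add,
    ENNReal.ofReal_le_ofReal_iff] at hle
  · have t1 := dist_triangle x (γ s) (γ t)
    have t2 := dist_triangle x (γ t) y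
    linarith
  all_goals positivity

/-- In a geodesic space, any two points are joined by a constant-speed geodesic. -/
theorem IsGeodesicSpace.exists_isConstantSpeedGeodesic {X : Type*} [PseudoMetricSpace X]
    (hX : IsGeodesicSpace X) (x y : X) :
    ∃ γ : C(unitInterval, X), IsConstantSpeedGeodesic x y γ := by
  obtain ⟨γ, hγ⟩ := hX x y
  obtain ⟨hc, h0, h1, -⟩ := id hγ
  have hL : 0 ≤ dist x y := dist_nonneg
  have hρ : ContinuousOn (fun s => dist x (γ s)) (Icc 0 (dist x y)) := by fun_prop
  -- The endpoints are prescribed because distance 0 does not determine a point in a pseudometric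
  -- space.
  have key : ∀ S : unitInterval, ∃ u ∈ Icc 0 (dist x y), dist x (γ u) = S * dist x y ∧
      (S = 0 → u = 0) ∧ (S = 1 → u = dist x y) := by
    intro S
    by_cases hS0 : S = 0
    · by_cases hS1 : S = 1
      · exact absurd (hS0.symm.trans hS1) zero_ne_one
      · exact ⟨0, ⟨le_rfl, hL⟩, by simp [h0, hS0], fun _ => rfl, fun h => absurd h hS1⟩
    by_cases hS1 : S = 1
    · exact ⟨dist x y, ⟨hL, le_rfl⟩, by simp [h1, hS1], fun h => absurd h hS0, fun _ => rfl⟩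
    have := intermediate_value_Icc hL hρ
    simp only [h0, h1, dist_self] at this
    obtain ⟨u, hu, hu'⟩ := this
      ⟨mul_nonneg S.2.1 hL, mul_le_of_le_one_left hL S.2.2⟩
    exact ⟨u, hu, hu', fun h => absurd h hS0, fun h => absurd h hS1⟩
  choose u hu hud hu0 hu1 using key
  have hdist : ∀ S T : unitInterval,
      dist (γ (u S)) (γ (u T)) = |(T : ℝ) - (S : ℝ)| * dist x y := by
    intro S T
    rw [show |(T : ℝ) - S| * dist x y = |T * dist x y - S * dist x y| by
      rw [← sub_mul, abs_mul, abs_of_nonneg hL], ← hud, ← hud]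
    rcases le_total (u S) (u T) with h | h
    · have := hγ.dist_eq (hu S).1 h (hu T).2
      rw [← this, abs_of_nonneg dist_nonneg]
    · have := hγ.dist_eq (hu T).1 h (hu S).2
      rw [abs_sub_comm, ← this, abs_of_nonneg dist_nonneg, dist_comm]
  -- The choice of `u` need not be continuous, but the composite is Lipschitz.
  have hcont : Continuous fun S => γ (u S) := by
    refine (LipschitzWith.of_dist_le_mul (K := ⟨dist x y, hL⟩) fun S T => ?_).continuous
    rw [hdist, mul_comm, Subtype.dist_eq, Real.dist_eq, abs_sub_comm]
    rfl
  exact ⟨⟨_, hcont⟩, by simp [hu0 0 rfl, h0], by simp [hu1 1 rfl, h1], hdist⟩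

/-- A constant-speed geodesic, parametrized by arc length, is a geodesic. -/
theorem IsConstantSpeedGeodesic.exists_isGeodesic {X : Type*} [MetricSpace X] {x y : X}
    {γ : unitInterval → X} (h : IsConstantSpeedGeodesic x y γ) :
    ∃ γ' : ℝ → X, IsGeodesic x y γ' := by
  obtain ⟨h0, h1, hd⟩ := h
  rcases eq_or_ne x y with rfl | hne
  · refine ⟨fun _ => x, continuousOn_const, rfl, rfl, ?_⟩
    rw [eVariationOn.constant_on]
    · simp
    · exact subsingleton_singleton.anti (image_subset_iff.2 fun _ _ => rfl)
  -- Rescaled to arc length, the curve is an isometric embedding of the interval. Its length is at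
  -- most d(x, y) since it is 1-Lipschitz, and at least the endpoint chord.
  have hL : 0 < dist x y := dist_pos.2 hne
  let γ' : ℝ → X := fun t => γ (projIcc 0 1 zero_le_one (t / dist x y))
  have hd' : ∀ s ∈ Icc 0 (dist x y), ∀ t ∈ Icc 0 (dist x y), dist (γ' s) (γ' t) = dist s t := by
    intro s hs t ht
    have hm : ∀ s ∈ Icc 0 (dist x y), s / dist x y ∈ Icc (0 : ℝ) 1 := fun s hs =>
      ⟨div_nonneg hs.1 hL.le, (div_le_one hL).2 hs.2⟩
    simp only [γ', projIcc_of_mem zero_le_one (hm s hs), projIcc_of_mem zero_le_one (hm t ht)]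
    rw [hd, ← sub_div, abs_div, abs_of_pos hL, div_mul_cancel₀ _ hL.ne', Real.dist_eq,
      abs_sub_comm]
  have hlip : LipschitzOnWith 1 γ' (Icc 0 (dist x y)) :=
    LipschitzOnWith.of_dist_le_mul fun s hs t ht => by simpa using (hd' s hs t ht).le
  have e0 : γ' 0 = x := by simp [γ', h0]
  have e1 : γ' (dist x y) = y := by simp [γ', h1, div_self hL.ne']
  refine ⟨γ', hlip.continuousOn, e0, e1, le_antisymm ?_ ?_⟩
  · have := hlip.comp_eVariationOn_le (f := γ') (g := fun t : ℝ => t) (t := Icc 0 (dist x y))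
      (s := Icc 0 (dist x y)) (fun t ht => ht)
    refine this.trans ?_
    have h2 := MonotoneOn.eVariationOn_eq (f := fun t : ℝ => t) (s := Icc 0 (dist x y))
      (fun _ _ _ _ h => h) (left_mem_Icc.2 hL.le) (right_mem_Icc.2 hL.le)
    rw [inter_self, sub_zero] at h2
    rw [h2, ENNReal.coe_one, one_mul]
  · have := eVariationOn.edist_le γ' (s := Icc 0 (dist x y)) (left_mem_Icc.2 hL.le)
      (right_mem_Icc.2 hL.le)
    rwa [e0, e1, edist_dist] at this

/-- The pairs of points together with a constant-speed geodesic joining them. -/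
def constantSpeedGeodesics (E : Type*) [MetricSpace E] : Set ((E × E) × C(unitInterval, E)) :=
  {p | IsConstantSpeedGeodesic p.1.1 p.1.2 p.2}

/-- Each defining equation compares continuous functions, since evaluation at a time is continuous
in the uniform topology. -/
theorem isClosed_constantSpeedGeodesics (E : Type*) [MetricSpace E] :
    IsClosed (constantSpeedGeodesics E) := by
  have h : ∀ S : unitInterval, Continuous fun p : (E × E) × C(unitInterval, E) => p.2 S :=
    fun S => (continuous_eval_const S).comp continuous_snd
  have h3 : IsClosed {p : (E × E) × C(unitInterval, E) | ∀ S T : unitInterval,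
      dist (p.2 S) (p.2 T) = |(T : ℝ) - (S : ℝ)| * dist p.1.1 p.1.2} := by
    simp only [ofPred_forall]
    refine isClosed_iInter fun S => isClosed_iInter fun T => ?_
    exact isClosed_eq ((h S).dist (h T)) (by fun_prop)
  exact (isClosed_eq (h 0) (by fun_prop)).inter ((isClosed_eq (h 1) (by fun_prop)).inter h3)

/-- Constant-speed geodesics can be chosen in a Borel way off a null set, on which constant curves
are chosen instead. -/
theorem exists_measurable_geodesic {E : Type*} [MetricSpace E] [PolishSpace E]
    [MeasurableSpace E] [BorelSpace E] [Nonempty E] (hE : IsGeodesicSpace E)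
    (μ : Measure (E × E)) [IsFiniteMeasure μ] :
    ∃ g : E × E → C(unitInterval, E), Measurable[inferInstance, borel C(unitInterval, E)] g ∧
      (∀ᵐ p ∂μ, IsConstantSpeedGeodesic p.1 p.2 (g p)) ∧
      ∀ p T, dist p.1 (g p T) ≤ dist p.1 p.2 := by
  classical
  let : MeasurableSpace C(unitInterval, E) := borel _
  have : BorelSpace C(unitInterval, E) := ⟨rfl⟩
  have : PolishSpace (constantSpeedGeodesics E) := (isClosed_constantSpeedGeodesics E).polishSpace
  let : MeasurableSpace (constantSpeedGeodesics E) := borel _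
  have : BorelSpace (constantSpeedGeodesics E) := ⟨rfl⟩
  have hsurj : Function.Surjective fun p : constantSpeedGeodesics E => p.1.1 := fun p =>
    let ⟨γ, hγ⟩ := hE.exists_isConstantSpeedGeodesic p.1 p.2
    ⟨⟨(p, γ), hγ⟩, rfl⟩
  have : Nonempty (constantSpeedGeodesics E) :=
    (hsurj (Classical.arbitrary E, Classical.arbitrary E)).nonempty
  obtain ⟨s, N, hs, hN, hμN, hsN⟩ :=
    (show Continuous fun p : constantSpeedGeodesics E => p.1.1 by
      fun_prop).exists_measurable_ae_rightInverse μ hsurj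
  have hsnd : Continuous fun p : constantSpeedGeodesics E => p.1.2 := by fun_prop
  have hg : ∀ p ∈ N, IsConstantSpeedGeodesic p.1 p.2 (s p).1.2 := by
    intro p hp
    have h1 : IsConstantSpeedGeodesic (s p).1.1.1 (s p).1.1.2 (s p).1.2 := (s p).2
    rwa [hsN p hp] at h1
  -- Constant curves keep the distance bound valid everywhere, as needed for bounded rather than
  -- essentially bounded images.
  refine ⟨N.piecewise (fun p => (s p).1.2) fun p => .const _ p.1, ?_, ?_, ?_⟩
  · exact Measurable.piecewise hN (hsnd.measurable.comp hs)
      (ContinuousMap.continuous_const'.measurable.comp measurable_fst)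
  · have : ∀ᵐ p ∂μ, p ∈ N := by rw [ae_iff]; exact hμN
    filter_upwards [this] with p hp
    rw [piecewise_eq_of_mem _ _ _ hp]
    exact hg p hp
  · intro p T
    by_cases hp : p ∈ N
    · rw [piecewise_eq_of_mem _ _ _ hp]
      obtain ⟨h0, -, hd⟩ := hg p hp
      have := hd 0 T
      rw [h0] at this
      rw [this]
      refine mul_le_of_le_one_left dist_nonneg ?_
      simpa [abs_of_nonneg T.2.1] using T.2.2
    · rw [piecewise_eq_of_notMem _ _ _ hp]
      simp

/-! ### Subdivisions as a starting time and a curve -/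

namespace SubdivisionRep

variable {E : Type*} [MetricSpace E] [MeasurableSpace E] {Δ : ℝ}

/-- A subdivision with its time interval shifted to start at `0`. -/
noncomputable def curve (P : SubdivisionRep E Δ) (t : ℝ) : E := P.toFun (t + P.left)

theorem right_eq (P : SubdivisionRep E Δ) : P.right = Δ + P.left := by
  have := P.length_dom
  unfold left right
  linarith

/-- The domain lies between the open and the closed interval, which differ by a null set, so the
type of interval does not matter. -/
theorem restrict_dom (P : SubdivisionRep E Δ) :
    volume.restrict P.dom = (volume.restrict (Ioc 0 Δ)).map (· + P.left) := by
  have h1 : P.dom =ᵐ[volume] Ioc P.left P.right :=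
    ((P.dom_subset_Icc.eventuallyLE).trans Ioc_ae_eq_Icc.symm.le).antisymm
      (Ioo_ae_eq_Ioc.symm.le.trans P.Ioo_subset_dom.eventuallyLE)
  have h2 : Ioc 0 Δ = (· + P.left) ⁻¹' Ioc P.left P.right := by
    rw [right_eq]
    ext t
    simp
  rw [Measure.restrict_congr_set h1, h2]
  exact ((measurePreserving_add_right volume P.left).restrict_preimage measurableSet_Ioc).map_eq.symm

theorem ae_dom_iff (P : SubdivisionRep E Δ) {p : ℝ → Prop} :
    (∀ᵐ t ∂volume.restrict P.dom, p t) ↔ ∀ᵐ t ∂volume.restrict (Ioc 0 Δ), p (t + P.left) := by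
  rw [restrict_dom, (measurableEmbedding_addRight P.left).ae_map_iff]

theorem equiv_iff (P Q : SubdivisionRep E Δ) :
    Equiv P Q ↔ P.left = Q.left ∧ P.curve =ᵐ[volume.restrict (Ioc 0 Δ)] Q.curve := by
  have hdom : P.left = Q.left → (volume {t : ℝ | t ∈ P.dom ∩ Q.dom ∧ P.toFun t ≠ Q.toFun t} = 0 ↔
      P.curve =ᵐ[volume.restrict (Ioc 0 Δ)] Q.curve) := by
    intro hl
    have h1 : volume.restrict P.dom = volume.restrict Q.dom := by
      rw [restrict_dom, restrict_dom, hl]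
    have h2 : volume.restrict (P.dom ∩ Q.dom) = volume.restrict P.dom := by
      rw [← Measure.restrict_restrict P.ordConnected_dom.measurableSet, ← h1,
        Measure.restrict_restrict P.ordConnected_dom.measurableSet, inter_self]
    have h3 : (volume {t : ℝ | t ∈ P.dom ∩ Q.dom ∧ P.toFun t ≠ Q.toFun t} = 0) ↔
        ∀ᵐ t ∂volume.restrict (P.dom ∩ Q.dom), P.toFun t = Q.toFun t := by
      rw [ae_restrict_iff' (P.ordConnected_dom.measurableSet.inter
        Q.ordConnected_dom.measurableSet), ae_iff]
      simp only [Classical.not_imp, ne_eq]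
    rw [h3, h2, ae_dom_iff]
    simp only [Filter.EventuallyEq, curve, hl]
  constructor
  · rintro ⟨hl, -, h⟩
    exact ⟨hl, (hdom hl).1 h⟩
  · rintro ⟨hl, h⟩
    exact ⟨hl, by rw [right_eq, right_eq, hl], (hdom hl).2 h⟩

/-- The open interval is used because the endpoints may lie outside the domain, where values are
arbitrary. -/
theorem isBounded_curve (P : SubdivisionRep E Δ) : Bornology.IsBounded (P.curve '' Ioo 0 Δ) := by
  refine P.isBounded_image.subset ?_
  rintro _ ⟨t, ht, rfl⟩
  refine mem_image_of_mem _ (P.Ioo_subset_dom ?_)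
  rw [right_eq]
  exact ⟨by linarith [ht.1], by linarith [ht.2]⟩

theorem exists_dist_curve_le (P Q : SubdivisionRep E Δ) :
    ∃ C, ∀ s ∈ Ioo 0 Δ, ∀ t ∈ Ioo 0 Δ, dist (P.curve s) (Q.curve t) ≤ C := by
  obtain ⟨C, hC⟩ := Metric.isBounded_iff.1 (P.isBounded_curve.union Q.isBounded_curve)
  exact ⟨C, fun s hs t ht => hC (Or.inl (mem_image_of_mem _ hs)) (Or.inr (mem_image_of_mem _ ht))⟩

theorem aemeasurable_curve [PolishSpace E] [BorelSpace E] (P : SubdivisionRep E Δ) :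
    AEMeasurable P.curve (volume.restrict (Ioc 0 Δ)) := by
  have h := P.nullMeasurable.aemeasurable
  rw [restrict_dom] at h
  exact h.comp_measurable (measurable_add_const P.left)

theorem integrable_dist_curve [PolishSpace E] [BorelSpace E] (P Q : SubdivisionRep E Δ) :
    Integrable (fun t => dist (P.curve t) (Q.curve t)) (volume.restrict (Ioc 0 Δ)) := by
  obtain ⟨C, hC⟩ := P.exists_dist_curve_le Q
  refine Integrable.of_bound (P.aemeasurable_curve.dist Q.aemeasurable_curve).aestronglyMeasurable
    C ?_
  rw [← Measure.restrict_congr_set Ioo_ae_eq_Ioc]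
  filter_upwards [ae_restrict_mem measurableSet_Ioo] with t ht
  rw [Real.norm_of_nonneg dist_nonneg]
  exact hC t ht t ht

theorem cost_eq [PolishSpace E] [BorelSpace E] (hΔ : 0 ≤ Δ) (α : ℝ) (P Q : SubdivisionRep E Δ) :
    cost α P Q = (1 - α) * (∫ t in Ioc 0 Δ, dist (P.curve t) (Q.curve t)) +
      α * Δ * |Q.left - P.left| := by
  have h1 : cost α P Q =
      ∫ t in 0..Δ, ((1 - α) * dist (P.curve t) (Q.curve t) + α * |Q.left - P.left|) := by
    have h := intervalIntegral.integral_comp_add_right (a := 0) (b := Δ) (fun t =>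
      (1 - α) * dist (P.toFun t) (Q.toFun (t + Q.left - P.left)) + α * |Q.left - P.left|) P.left
    rw [zero_add, ← right_eq] at h
    unfold cost
    rw [← h]
    refine intervalIntegral.integral_congr fun t _ => ?_
    simp only [curve, show t + P.left + Q.left - P.left = t + Q.left by ring]
  rw [h1, intervalIntegral.integral_of_le hΔ,
    integral_add ((P.integrable_dist_curve Q).const_mul _) (integrable_const _),
    integral_const_mul, integral_const]
  simp only [measureReal_restrict_apply MeasurableSet.univ, univ_inter, Real.volume_real_Ioc,
    sub_zero, max_eq_left hΔ, smul_eq_mul]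
  ring

/-- The subdivision which starts at time `l` and follows `f`. -/
noncomputable def ofCurve (hΔ : 0 < Δ) (l : ℝ) (f : ℝ → E) (hf : AEMeasurable f (volume.restrict (Ioc 0 Δ)))
    (hb : Bornology.IsBounded (f '' Ioo 0 Δ)) : SubdivisionRep E Δ where
  dom := Ioo l (Δ + l)
  toFun t := f (t - l)
  ordConnected_dom := ordConnected_Ioo
  isBounded_dom := Metric.isBounded_Ioo _ _
  length_dom := by
    have : l < Δ + l := by linarith
    rw [csSup_Ioo this, csInf_Ioo this]
    ring
  nullMeasurable := by
    have h2 : Ioo l (Δ + l) = (· - l) ⁻¹' Ioo 0 Δ := by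
      ext t
      simp
    rw [← Measure.restrict_congr_set Ioo_ae_eq_Ioc] at hf
    rw [h2]
    exact (hf.comp_quasiMeasurePreserving ((measurePreserving_sub_right volume l).restrict_preimage
      measurableSet_Ioo).quasiMeasurePreserving).nullMeasurable
  isBounded_image := by
    refine hb.subset ?_
    rintro _ ⟨t, ht, rfl⟩
    exact mem_image_of_mem _ ⟨by linarith [ht.1], by linarith [ht.2]⟩

theorem left_ofCurve (hΔ : 0 < Δ) (l : ℝ) (f : ℝ → E) (hf hb) :
    (ofCurve hΔ l f hf hb).left = l := csInf_Ioo (by linarith)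

theorem curve_ofCurve (hΔ : 0 < Δ) (l : ℝ) (f : ℝ → E) (hf hb) :
    (ofCurve hΔ l f hf hb).curve = f := by
  ext t
  rw [curve, left_ofCurve]
  simp [ofCurve]

end SubdivisionRep

/-! ### The metric and its geodesics -/

open SubdivisionRep

variable {E : Type*} [MetricSpace E] [MeasurableSpace E] [PolishSpace E] [BorelSpace E] {Δ : ℝ}

/-- The space of subdivisions as a metric space. -/
noncomputable abbrev subdivisionMetricSpace (E : Type*) [MetricSpace E] [MeasurableSpace E]
    [PolishSpace E] [BorelSpace E] {α : ℝ} (hα : α ∈ Ioo (0 : ℝ) 1) (hΔ : 0 < Δ) :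
    MetricSpace (SubdivisionSpace E Δ) where
  dist := subdivisionDist α
  dist_self p := by
    induction p using Quotient.inductionOn with | h P => ?_
    change cost α P P = 0
    simp [cost_eq hΔ.le]
  dist_comm p q := by
    induction p, q using Quotient.inductionOn₂ with | h P Q => ?_
    change cost α P Q = cost α Q P
    simp only [cost_eq hΔ.le, dist_comm (P.curve _), abs_sub_comm Q.left]
  dist_triangle p q r := by
    induction p, q, r using Quotient.inductionOn₃ with | h P Q R => ?_
    change cost α P R ≤ cost α P Q + cost α Q R
    simp only [cost_eq hΔ.le]
    have h1 : ∫ t in Ioc 0 Δ, dist (P.curve t) (R.curve t) ≤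
        (∫ t in Ioc 0 Δ, dist (P.curve t) (Q.curve t)) +
          ∫ t in Ioc 0 Δ, dist (Q.curve t) (R.curve t) := by
      rw [← integral_add (P.integrable_dist_curve Q) (Q.integrable_dist_curve R)]
      exact integral_mono (P.integrable_dist_curve R)
        ((P.integrable_dist_curve Q).add (Q.integrable_dist_curve R))
        fun t => dist_triangle _ _ _
    have h2 := abs_sub_le R.left Q.left P.left
    have h3 := mul_le_mul_of_nonneg_left h1 (sub_nonneg.2 hα.2.le)
    have h4 := mul_le_mul_of_nonneg_left h2 (mul_pos hα.1 hΔ).le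
    linarith
  eq_of_dist_eq_zero {p q} := by
    induction p, q using Quotient.inductionOn₂ with | h P Q => ?_
    intro h
    change cost α P Q = 0 at h
    rw [cost_eq hΔ.le] at h
    have h1 : 0 ≤ ∫ t in Ioc 0 Δ, dist (P.curve t) (Q.curve t) :=
      integral_nonneg fun _ => dist_nonneg
    have hα' : 0 < 1 - α := sub_pos.2 hα.2
    have h2 : 0 < α * Δ := mul_pos hα.1 hΔ
    -- Both terms vanish: α > 0 then forces equal starting times, and α < 1 forces curves equal
    -- almost everywhere.
    obtain ⟨h3, h4⟩ := (add_eq_zero_iff_of_nonneg (mul_nonneg hα'.le h1)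
      (mul_nonneg h2.le (abs_nonneg _))).1 h
    refine Quotient.sound ((equiv_iff P Q).2 ⟨?_, ?_⟩)
    · have := (mul_eq_zero.1 h4).resolve_left h2.ne'
      exact (sub_eq_zero.1 (abs_eq_zero.1 this)).symm
    · have := (mul_eq_zero.1 h3).resolve_left hα'.ne'
      rw [integral_eq_zero_iff_of_nonneg (fun _ => dist_nonneg) (P.integrable_dist_curve Q)] at this
      filter_upwards [this] with t ht
      exact dist_eq_zero.1 ht

/-- Moving each point of a subdivision along a measurably chosen geodesic gives a constant-speed
geodesic of subdivisions. -/
theorem exists_geodesic_subdivisions (hE : IsGeodesicSpace E) (α : ℝ) (hΔ : 0 < Δ)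
    (P Q : SubdivisionRep E Δ) :
    ∃ (g : E × E → C(unitInterval, E)) (G : unitInterval → SubdivisionRep E Δ),
      Measurable[inferInstance, borel C(unitInterval, E)] g ∧
      (∀ᵐ t ∂(volume.restrict (Ioc 0 Δ)),
        IsConstantSpeedGeodesic (P.curve t) (Q.curve t) (g (P.curve t, Q.curve t))) ∧
      (∀ T : unitInterval, (G T).left = (1 - (T : ℝ)) * P.left + (T : ℝ) * Q.left ∧
        ∀ t, (G T).curve t = g (P.curve t, Q.curve t) T) ∧
      (G 0).Equiv P ∧ (G 1).Equiv Q ∧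
      ∀ S T : unitInterval, cost α (G S) (G T) = |(T : ℝ) - (S : ℝ)| * cost α P Q := by
  have : Nonempty E := ⟨P.curve 0⟩
  have hPQ : AEMeasurable (fun t => (P.curve t, Q.curve t)) (volume.restrict (Ioc 0 Δ)) :=
    P.aemeasurable_curve.prodMk Q.aemeasurable_curve
  -- With the joint law of the two curves as measure, null sets of pairs pull back to null sets of
  -- times.
  obtain ⟨g, hg, hgeo, hbd⟩ := exists_measurable_geodesic hE
    ((volume.restrict (Ioc 0 Δ)).map fun t => (P.curve t, Q.curve t))
  replace hgeo := ae_of_ae_map hPQ hgeo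
  have hm : ∀ T : unitInterval,
      AEMeasurable (fun t => g (P.curve t, Q.curve t) T) (volume.restrict (Ioc 0 Δ)) := by
    intro T
    let : MeasurableSpace C(unitInterval, E) := borel _
    have : BorelSpace C(unitInterval, E) := ⟨rfl⟩
    have h1 : Measurable fun f : C(unitInterval, E) => f T := (continuous_eval_const T).measurable
    exact (h1.comp hg).comp_aemeasurable hPQ
  have hb : ∀ T : unitInterval,
      Bornology.IsBounded ((fun t => g (P.curve t, Q.curve t) T) '' Ioo 0 Δ) := by
    intro T
    obtain ⟨C, hC⟩ := P.exists_dist_curve_le Q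
    refine (P.isBounded_curve.cthickening (δ := C)).subset ?_
    rintro _ ⟨t, ht, rfl⟩
    refine Metric.mem_cthickening_of_dist_le _ (P.curve t) _ _ (mem_image_of_mem _ ht) ?_
    rw [dist_comm]
    exact (hbd (P.curve t, Q.curve t) T).trans (hC t ht t ht)
  let G : unitInterval → SubdivisionRep E Δ := fun T =>
    ofCurve hΔ ((1 - (T : ℝ)) * P.left + (T : ℝ) * Q.left) _ (hm T) (hb T)
  have hl : ∀ T, (G T).left = (1 - (T : ℝ)) * P.left + (T : ℝ) * Q.left :=
    fun T => left_ofCurve _ _ _ _ _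
  have hc : ∀ T, (G T).curve = fun t => g (P.curve t, Q.curve t) T :=
    fun T => curve_ofCurve _ _ _ _ _
  refine ⟨g, G, hg, hgeo, fun T => ⟨hl T, fun t => congrFun (hc T) t⟩, ?_, ?_, ?_⟩
  · refine (equiv_iff _ _).2 ⟨by simp [hl], ?_⟩
    rw [hc]
    filter_upwards [hgeo] with t ht using ht.1
  · refine (equiv_iff _ _).2 ⟨by simp [hl], ?_⟩
    rw [hc]
    filter_upwards [hgeo] with t ht using ht.2.1
  · intro S T
    have h1 : ∫ t in Ioc 0 Δ, dist ((G S).curve t) ((G T).curve t) =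
        |(T : ℝ) - S| * ∫ t in Ioc 0 Δ, dist (P.curve t) (Q.curve t) := by
      rw [← integral_const_mul]
      refine integral_congr_ae ?_
      rw [hc, hc]
      filter_upwards [hgeo] with t ht using ht.2.2 S T
    have h2 : |(G T).left - (G S).left| = |(T : ℝ) - S| * |Q.left - P.left| := by
      rw [← abs_mul, hl, hl]
      congr 1
      ring
    rw [cost_eq hΔ.le, cost_eq hΔ.le, h1, h2]
    ring

end ContinuousEditDistance

open ContinuousEditDistance in
theorem mainTheorem5 {E : Type*} [MetricSpace E] [PolishSpace E] [MeasurableSpace E] [BorelSpace E]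
    (hE : IsGeodesicSpace E) (α : ℝ) (hα : α ∈ Set.Ioo (0 : ℝ) 1) (Δ : ℝ) (hΔ : 0 < Δ) :
    ∃ m : MetricSpace (SubdivisionSpace E Δ),
      (∀ p q : SubdivisionSpace E Δ, m.dist p q = subdivisionDist α p q) ∧
      @IsGeodesicSpace (SubdivisionSpace E Δ) m.toPseudoMetricSpace ∧
      ∀ P Q : SubdivisionRep E Δ,
        ∃ (g : E × E → C(unitInterval, E)) (G : unitInterval → SubdivisionRep E Δ),
          Measurable[inferInstance, borel C(unitInterval, E)] g ∧
          (∀ᵐ t ∂(volume.restrict P.dom),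
            IsConstantSpeedGeodesic (P.toFun t) (Q.toFun (t + Q.left - P.left))
              (g (P.toFun t, Q.toFun (t + Q.left - P.left)))) ∧
          (∀ T : unitInterval,
            (G T).left = (1 - (T : ℝ)) * P.left + (T : ℝ) * Q.left ∧
            (G T).right = (1 - (T : ℝ)) * P.right + (T : ℝ) * Q.right ∧
            ∀ᵐ t ∂(volume.restrict P.dom),
              (G T).toFun (t + (G T).left - P.left) =
                g (P.toFun t, Q.toFun (t + Q.left - P.left)) T) ∧
          @IsConstantSpeedGeodesic (SubdivisionSpace E Δ) m.toPseudoMetricSpace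
            P.toSpace Q.toSpace (fun T => (G T).toSpace) ∧
          (∀ S T : unitInterval,
            subdivisionDist α (G S).toSpace (G T).toSpace =
              |(T : ℝ) - (S : ℝ)| * subdivisionDist α P.toSpace Q.toSpace) := by
  have hshift : ∀ (P Q : SubdivisionRep E Δ) (t : ℝ),
      Q.toFun (t + P.left + Q.left - P.left) = Q.curve t := by
    intro P Q t
    rw [SubdivisionRep.curve, show t + P.left + Q.left - P.left = t + Q.left by ring]
  let m : MetricSpace (SubdivisionSpace E Δ) := subdivisionMetricSpace E hα hΔ
  refine ⟨m, fun _ _ => rfl, ?_, ?_⟩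
  · intro p q
    induction p, q using Quotient.inductionOn₂ with | h P Q => ?_
    obtain ⟨g, G, -, -, -, h0, h1, hd⟩ := exists_geodesic_subdivisions hE α hΔ P Q
    exact IsConstantSpeedGeodesic.exists_isGeodesic (γ := fun T => (G T).toSpace)
      ⟨Quotient.sound h0, Quotient.sound h1, hd⟩
  · intro P Q
    obtain ⟨g, G, hg, hgeo, hG, h0, h1, hd⟩ := exists_geodesic_subdivisions hE α hΔ P Q
    refine ⟨g, G, hg, ?_, fun T => ⟨(hG T).1, ?_, ?_⟩,
      ⟨Quotient.sound h0, Quotient.sound h1, hd⟩, hd⟩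
    · rw [P.ae_dom_iff]
      filter_upwards [hgeo] with t ht
      rw [hshift]
      exact ht
    · rw [SubdivisionRep.right_eq, (hG T).1, SubdivisionRep.right_eq, SubdivisionRep.right_eq]
      ring
    · rw [P.ae_dom_iff]
      refine Filter.Eventually.of_forall fun t => ?_
      rw [hshift, hshift, (hG T).2]
      rfl
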